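/- A weighted graph $(E,\omega)$ consists of countable sets $E^0$ (vertices) and $E^{\mathrm{st}}$ (structured edges), maps $s,r:E^{\mathrm{st}}\to E^0$ and a weight map $\omega:E^{\mathrm{st}}\to\{1,2,3,\dots\}$. It is assumed to be row-finite: $s^{-1}(v)$ is finite for every $v\in E^0$. Each $\alpha\in E^{\mathrm{st}}$ gives rise to $\omega(\alpha)$ distinct edges $\alpha_1,\dots,\alpha_{\omega(\alpha)}$. If $s^{-1}(v)\neq\emptyset$, put $\omega(v)=\max\{\omega(\alpha)\mid s(\alpha)=v\}$. For a (not necessarily commutative) unital ring $R$, the weighted Leavitt path algebra $L_R(E,\omega)$ is the (not necessarily unital) ring $R\langle X\rangle/I$. Here $X$ is the disjoint union of $E^0$, the set of all edges $\alpha_i$, and the set of all symbols $\alpha_i^*$; $R\langle X\rangle$ is the free left $R$-module on the nonempty words over $X$, with multiplication determined by $(ax)(by)=(ab)(xy)$ for $a,b\in R$ and words $x,y$; and $I$ is the smallest two-sided ideal that is an $R$-subbimodule and contains the relations 1. $vw=\delta_{vw}v$ for $v,w\in E^0$; 2. $s(\alpha)\alpha_i=\alpha_i=\alpha_i r(\alpha)$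 and $r(\alpha)\alpha_i^*=\alpha_i^*=\alpha_i^*s(\alpha)$ for $\alpha\in E^{\mathrm{st}}$, $1\le i\le\omega(\alpha)$; 3. $\sum_{s(\alpha)=v}\alpha_i\alpha_j^*=\delta_{ij}v$ for $v\in E^0$ with $s^{-1}(v)\ne\emptyset$ and $1\le i,j\le\omega(v)$; 4. $\sum_{1\le i\le\max\{\omega(\alpha),\omega(\beta)\}}\alpha_i^*\beta_i=\delta_{\alpha\beta}r(\alpha)$ for $\alpha,\beta\in E^{\mathrm{st}}$, where $\alpha_i$ and $\alpha_i^*$ are read as $0$ if $i>\omega(\alpha)$. It is a $\mathbb Z^n$-graded ring with $\deg v=0$, $\deg\alpha_i=e_i$, $\deg\alpha_i^*=-e_i$ and the elements of $R$ in degree $0$, where $n$ is the largest weight (if the weights are unbounded, $\mathbb Z^n$ is replaced by the direct sum of countably many copies of $\mathbb Z$). $(E,\omega)$ is called an LV-graph if $E^{\mathrm{st}}\neq\emptyset$; any two vertices are joined by a path that may traverse structured edges in either direction; $\omega(\alpha)\ge 2$ for all $\alpha\in E^{\mathrm{st}}$; and for every $v\in E^0$ with $s^{-1}(v)\ne\emptyset$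 there are at least two $\alpha\in s^{-1}(v)$ with $\omega(\alpha)=\omega(v)$. A ring $A$ is von Neumann regular if for every $a\in A$ there is $b\in A$ with $aba=a$. A graded ring $A$ is graded von Neumann regular if this holds for every homogeneous $a\in A$. **Theorem.** Let $(E,\omega)$ be an LV-graph and let $R$ be a domain (a nonzero unital ring, not necessarily commutative, without zero divisors). Then $L_R(E,\omega)$ is not graded von Neumann regular, and hence not von Neumann regular. -/

import Mathlib

/-- A ring `A`, not necessarily with unit, is von Neumann regular if for every `a` there is
`b` with `a b a = a`. -/
def IsVonNeumannRegular (A : Type*) [NonUnitalRing A] : Prop :=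
  ∀ a : A, ∃ b : A, a * b * a = a

/-- A graded ring `A = ⨁ g, 𝒜 g`, not necessarily with unit, is graded von Neumann regular if
for every homogeneous `a` there is `b` in `A` with `a b a = a`. -/
def IsGradedVonNeumannRegular {ι A : Type*} [DecidableEq ι] [Add ι] [NonUnitalRing A]
    (𝒜 : ι → AddSubgroup A) [SetLike.GradedMul 𝒜] [DirectSum.Decomposition 𝒜] : Prop :=
  ∀ a : A, SetLike.IsHomogeneousElem 𝒜 a → ∃ b : A, a * b * a = a

/-- A row-finite weighted graph with set of vertices `V` and set of structured edges `S`. -/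
structure WeightedGraph (V S : Type*) where
  src : S → V
  tgt : S → V
  weight : S → ℕ
  weight_pos : ∀ α, 0 < weight α
  rowFinite : ∀ v, {α | src α = v}.Finite

namespace WeightedGraph

variable {V S : Type*} (E : WeightedGraph V S)

/-- The finite set `s⁻¹(v)` of structured edges emitted by `v`. -/
noncomputable def out (v : V) : Finset S := (E.rowFinite v).toFinset

/-- `ω(v)`: the largest weight of a structured edge emitted by `v` (and `0` if `v` is a sink). -/
noncomputable def maxWeight (v : V) : ℕ := (E.out v).sup E.weight

/-- The alphabet: vertices `v`, edges `α_i` and ghost edges `α_i*`. The indices `i` of the edges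
of a structured edge `α` run through `0, …, ω(α) - 1` (instead of `1, …, ω(α)`). -/
inductive Letter : Type _
  | vertex (v : V) : Letter
  | edge (α : S) (i : Fin (E.weight α)) : Letter
  | ghost (α : S) (i : Fin (E.weight α)) : Letter

/-- One step of a generalised path: an edge from `u` to `v`, or a ghost edge from `u` to `v`
(that is, an edge from `v` to `u`). Every structured edge has at least one edge. -/
def Step (u v : V) : Prop :=
  ∃ α, (E.src α = u ∧ E.tgt α = v) ∨ (E.tgt α = u ∧ E.src α = v)

/-- LV-graphs. Connectedness: any two vertices are joined by a generalised path (there is at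
least one vertex since there is at least one structured edge). -/
structure IsLV : Prop where
  two_le_weight : ∀ α, 2 ≤ E.weight α
  two_le_card : ∀ v, (E.out v).Nonempty →
    2 ≤ ((E.out v).filter (fun α => E.weight α = E.maxWeight v)).card
  nonempty : Nonempty S
  connected : ∀ u v, Relation.ReflTransGen E.Step u v

section Algebra

variable (R : Type*) [Ring R]

/-- The free `R`-ring `R⟨X⟩` (without unit) on the alphabet `X`: the free left `R`-module on the
nonempty words, with multiplication `(r x) (s y) = (r s) (x y)`. -/
abbrev FreeRRing : Type _ := MonoidAlgebra R (FreeSemigroup E.Letter)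

/-- The vertex `v` as an element of the free `R`-ring. -/
noncomputable def freeVertex (v : V) : E.FreeRRing R :=
  MonoidAlgebra.single (FreeSemigroup.of (Letter.vertex v)) 1

/-- The edge `α_i` as an element of the free `R`-ring; it is zero if `i` is not an index of an edge
of `α`. -/
noncomputable def freeEdge (α : S) (i : ℕ) : E.FreeRRing R :=
  if h : i < E.weight α then
    MonoidAlgebra.single (FreeSemigroup.of (Letter.edge α ⟨i, h⟩)) 1 else 0

/-- The ghost edge `α_i*` as an element of the free `R`-ring; it is zero if `i` is not an index of
an edge of `α`. -/
noncomputable def freeGhost (α : S) (i : ℕ) : E.FreeRRing R :=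
  if h : i < E.weight α then
    MonoidAlgebra.single (FreeSemigroup.of (Letter.ghost α ⟨i, h⟩)) 1 else 0

open Classical in
/-- The defining relations of the weighted Leavitt path algebra. -/
inductive Rel : E.FreeRRing R → E.FreeRRing R → Prop
  | vertex_mul (v w : V) :
      Rel (E.freeVertex R v * E.freeVertex R w) (if v = w then E.freeVertex R v else 0)
  | src_mul_edge (α : S) (i : ℕ) (hi : i < E.weight α) :
      Rel (E.freeVertex R (E.src α) * E.freeEdge R α i) (E.freeEdge R α i)
  | edge_mul_tgt (α : S) (i : ℕ) (hi : i < E.weight α) :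
      Rel (E.freeEdge R α i * E.freeVertex R (E.tgt α)) (E.freeEdge R α i)
  | tgt_mul_ghost (α : S) (i : ℕ) (hi : i < E.weight α) :
      Rel (E.freeVertex R (E.tgt α) * E.freeGhost R α i) (E.freeGhost R α i)
  | ghost_mul_src (α : S) (i : ℕ) (hi : i < E.weight α) :
      Rel (E.freeGhost R α i * E.freeVertex R (E.src α)) (E.freeGhost R α i)
  | sum_edge_mul_ghost (v : V) (i j : ℕ) (hi : i < E.maxWeight v) (hj : j < E.maxWeight v) :
      Rel (∑ α ∈ E.out v, E.freeEdge R α i * E.freeGhost R α j)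
        (if i = j then E.freeVertex R v else 0)
  | sum_ghost_mul_edge (α β : S) :
      Rel (∑ i ∈ Finset.range (max (E.weight α) (E.weight β)),
          E.freeGhost R α i * E.freeEdge R β i)
        (if α = β then E.freeVertex R (E.tgt α) else 0)

/-- The ideal of the `R`-ring `R⟨X⟩` generated by the defining relations: the smallest two-sided
ideal that is an `R`-subbimodule and contains `x - y` for every defining relation `x = y`. -/
noncomputable def relIdeal : TwoSidedIdeal (E.FreeRRing R) :=
  sInf {I | (∀ x y, E.Rel R x y → x - y ∈ I) ∧
    ∀ (r : R) (x : E.FreeRRing R), x ∈ I → r • x ∈ I ∧ MulOpposite.op r • x ∈ I}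

/-- The weighted Leavitt path algebra `L_R(E, ω)`, a ring that need not have a unit. -/
def LeavittPathAlgebra : Type _ := (E.relIdeal R).ringCon.Quotient

noncomputable instance : NonUnitalRing (E.LeavittPathAlgebra R) :=
  inferInstanceAs (NonUnitalRing (E.relIdeal R).ringCon.Quotient)

/-- The quotient map from the free `R`-ring to the weighted Leavitt path algebra. -/
noncomputable def toLeavitt : E.FreeRRing R →ₙ+* E.LeavittPathAlgebra R where
  toFun x := ((x : (E.relIdeal R).ringCon.Quotient))
  map_mul' _ _ := rfl
  map_add' _ _ := rfl
  map_zero' := rfl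

end Algebra

section Grading

/-- The indices of edges that occur in the graph. If the weights have a maximum `n`, there are
exactly `n` of them. -/
abbrev Layer : Type := {i : ℕ // ∃ α, i < E.weight α}

/-- The grading group `ℤⁿ`, where `n` is the largest weight (the free abelian group on countably
many generators if the weights are unbounded). -/
abbrev GradingGroup : Type := E.Layer →₀ ℤ

/-- The degree of a letter: `deg v = 0`, `deg α_i = e_i`, `deg α_i* = -e_i`. -/
noncomputable def letterDegree : E.Letter → E.GradingGroup
  | Letter.vertex _ => 0
  | Letter.edge α i => Finsupp.single ⟨i, α, i.2⟩ 1
  | Letter.ghost α i => -Finsupp.single ⟨i, α, i.2⟩ 1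

/-- The degree of a word: the sum of the degrees of its letters. -/
noncomputable def degree (w : FreeSemigroup E.Letter) : E.GradingGroup :=
  (FreeSemigroup.lift (fun x => Multiplicative.ofAdd (E.letterDegree x)) w).toAdd

variable (R : Type*) [Ring R]

/-- The elements of the free `R`-ring all of whose words have degree `g`. -/
def freeComponent (g : E.GradingGroup) : AddSubgroup (E.FreeRRing R) where
  carrier := {x | ∀ w, x.coeff w ≠ 0 → E.degree w = g}
  zero_mem' := by intro w hw; simp at hw
  add_mem' := by
    intro x y hx hy w hw
    by_cases h : x.coeff w = 0
    · exact hy w (by intro h'; exact hw (by simp [h, h']))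
    · exact hx w h
  neg_mem' := by
    intro x hx w hw
    exact hx w (by simpa using hw)

/-- The homogeneous component of degree `g` of the weighted Leavitt path algebra. -/
noncomputable def component (g : E.GradingGroup) : AddSubgroup (E.LeavittPathAlgebra R) :=
  (E.freeComponent R g).map (E.toLeavitt R : E.FreeRRing R →+ E.LeavittPathAlgebra R)

/-! The components form a grading of the weighted Leavitt path algebra. -/

variable {E R}

theorem degree_of (x : E.Letter) : E.degree (FreeSemigroup.of x) = E.letterDegree x := by
  simp [degree]

theorem degree_mul (w w' : FreeSemigroup E.Letter) :
    E.degree (w * w') = E.degree w + E.degree w' := by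
  simp [degree]

theorem single_mem_freeComponent (w : FreeSemigroup E.Letter) (r : R) :
    MonoidAlgebra.single w r ∈ E.freeComponent R (E.degree w) := by
  classical
  intro w' hw'
  rw [MonoidAlgebra.coeff_single, Finsupp.single_apply] at hw'
  split_ifs at hw' with h
  · rw [h]
  · exact absurd rfl hw'

theorem mul_mem_freeComponent {g h : E.GradingGroup} {x y : E.FreeRRing R}
    (hx : x ∈ E.freeComponent R g) (hy : y ∈ E.freeComponent R h) :
    x * y ∈ E.freeComponent R (g + h) := by
  classical
  rw [MonoidAlgebra.mul_def]
  refine AddSubgroup.sum_mem _ fun a ha => AddSubgroup.sum_mem _ fun b hb => ?_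
  rw [← hx a (Finsupp.mem_support_iff.mp ha), ← hy b (Finsupp.mem_support_iff.mp hb),
    ← degree_mul]
  exact single_mem_freeComponent _ _

theorem mul_mem_component {g h : E.GradingGroup} {x y : E.LeavittPathAlgebra R}
    (hx : x ∈ E.component R g) (hy : y ∈ E.component R h) : x * y ∈ E.component R (g + h) := by
  obtain ⟨x, hx, rfl⟩ := hx
  obtain ⟨y, hy, rfl⟩ := hy
  exact ⟨x * y, mul_mem_freeComponent hx hy, map_mul (E.toLeavitt R) x y⟩

theorem toLeavitt_eq_zero_iff (x : E.FreeRRing R) : E.toLeavitt R x = 0 ↔ x ∈ E.relIdeal R := by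
  rw [TwoSidedIdeal.mem_iff]
  exact RingCon.eq _

theorem toLeavitt_surjective : Function.Surjective (E.toLeavitt R) := Quotient.mk''_surjective

theorem sub_mem_relIdeal {x y : E.FreeRRing R} (h : E.Rel R x y) : x - y ∈ E.relIdeal R := by
  rw [relIdeal, TwoSidedIdeal.mem_sInf]
  exact fun I hI => hI.1 x y h

theorem smul_mem_relIdeal {x : E.FreeRRing R} (hx : x ∈ E.relIdeal R) (r : R) :
    r • x ∈ E.relIdeal R ∧ MulOpposite.op r • x ∈ E.relIdeal R := by
  rw [relIdeal, TwoSidedIdeal.mem_sInf] at hx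
  rw [relIdeal, TwoSidedIdeal.mem_sInf, TwoSidedIdeal.mem_sInf]
  exact ⟨fun I hI => (hI.2 r x (hx I hI)).1, fun I hI => (hI.2 r x (hx I hI)).2⟩

open Classical in
/-- The projection of the free `R`-ring to its elements of degree `g`. -/
noncomputable def proj (g : E.GradingGroup) : E.FreeRRing R →+ E.FreeRRing R where
  toFun x := MonoidAlgebra.ofCoeff (x.coeff.filter (fun w => E.degree w = g))
  map_zero' := by rw [MonoidAlgebra.coeff_zero, Finsupp.filter_zero]; rfl
  map_add' x y := by simp [Finsupp.filter_add]

open Classical in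
theorem proj_single (g : E.GradingGroup) (w : FreeSemigroup E.Letter) (r : R) :
    proj g (MonoidAlgebra.single w r) =
      if E.degree w = g then MonoidAlgebra.single w r else 0 := by
  unfold proj
  split_ifs with h
  · simp [Finsupp.filter_single_of_pos, h]
  · simp [Finsupp.filter_single_of_neg, h]

open Classical in
theorem proj_of_mem {g h : E.GradingGroup} {x : E.FreeRRing R} (hx : x ∈ E.freeComponent R g) :
    proj h x = if g = h then x else 0 := by
  ext w
  simp only [proj, AddMonoidHom.coe_mk, ZeroHom.coe_mk, Finsupp.filter_apply]
  by_cases hw : x.coeff w = 0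
  · split_ifs <;> simp [hw]
  · rw [hx w hw]
    split_ifs <;> simp

theorem proj_smul (g : E.GradingGroup) (r : R) (x : E.FreeRRing R) :
    proj g (r • x) = r • proj g x := by
  ext w
  simp only [proj, AddMonoidHom.coe_mk, ZeroHom.coe_mk, Finsupp.filter_apply,
    MonoidAlgebra.coeff_smul_apply]
  split_ifs <;> simp

theorem proj_op_smul (g : E.GradingGroup) (r : R) (x : E.FreeRRing R) :
    proj g (MulOpposite.op r • x) = MulOpposite.op r • proj g x := by
  ext w
  simp only [proj, AddMonoidHom.coe_mk, ZeroHom.coe_mk, Finsupp.filter_apply,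
    MonoidAlgebra.coeff_smul_apply]
  split_ifs <;> simp

theorem proj_single_mul (g : E.GradingGroup) (w : FreeSemigroup E.Letter) (r : R)
    (x : E.FreeRRing R) : proj g (MonoidAlgebra.single w r * x) =
      MonoidAlgebra.single w r * proj (g - E.degree w) x := by
  induction x using MonoidAlgebra.induction_linear with
  | zero => simp
  | add x y hx hy => simp only [mul_add, map_add, hx, hy]
  | single w' s =>
    rw [MonoidAlgebra.single_mul_single, proj_single, proj_single, degree_mul]
    by_cases h : E.degree w' = g - E.degree w
    · rw [if_pos h, if_pos (by rw [h]; abel), MonoidAlgebra.single_mul_single]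
    · rw [if_neg h, if_neg (by rintro rfl; exact h (by abel)), mul_zero]

theorem proj_mul_single (g : E.GradingGroup) (w : FreeSemigroup E.Letter) (r : R)
    (x : E.FreeRRing R) : proj g (x * MonoidAlgebra.single w r) =
      proj (g - E.degree w) x * MonoidAlgebra.single w r := by
  induction x using MonoidAlgebra.induction_linear with
  | zero => simp
  | add x y hx hy => simp only [add_mul, map_add, hx, hy]
  | single w' s =>
    rw [MonoidAlgebra.single_mul_single, proj_single, proj_single, degree_mul]
    by_cases h : E.degree w' = g - E.degree w
    · rw [if_pos h, if_pos (by rw [h]; abel), MonoidAlgebra.single_mul_single]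
    · rw [if_neg h, if_neg (by rintro rfl; exact h (by abel)), zero_mul]

theorem freeVertex_mem (v : V) : E.freeVertex R v ∈ E.freeComponent R 0 := by
  have h := single_mem_freeComponent (R := R) (FreeSemigroup.of (Letter.vertex (E := E) v)) 1
  rwa [degree_of] at h

theorem freeEdge_mem (α : S) (i : ℕ) (hi : i < E.weight α) :
    E.freeEdge R α i ∈ E.freeComponent R (Finsupp.single ⟨i, α, hi⟩ 1) := by
  have h := single_mem_freeComponent (R := R)
    (FreeSemigroup.of (Letter.edge (E := E) α ⟨i, hi⟩)) 1
  rw [degree_of] at h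
  rw [freeEdge, dif_pos hi]
  exact h

theorem freeGhost_mem (α : S) (i : ℕ) (hi : i < E.weight α) :
    E.freeGhost R α i ∈ E.freeComponent R (-Finsupp.single ⟨i, α, hi⟩ 1) := by
  have h := single_mem_freeComponent (R := R)
    (FreeSemigroup.of (Letter.ghost (E := E) α ⟨i, hi⟩)) 1
  rw [degree_of] at h
  rw [freeGhost, dif_pos hi]
  exact h

theorem Rel.homogeneous {x y : E.FreeRRing R} (h : E.Rel R x y) :
    ∃ g, x - y ∈ E.freeComponent R g := by
  classical
  have key : ∀ g, x ∈ E.freeComponent R g → y ∈ E.freeComponent R g →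
      ∃ g, x - y ∈ E.freeComponent R g := fun g hx hy => ⟨g, sub_mem hx hy⟩
  cases h with
  | vertex_mul v w =>
    refine key 0 ?_ ?_
    · simpa using mul_mem_freeComponent (freeVertex_mem (R := R) v) (freeVertex_mem w)
    · split_ifs
      · exact freeVertex_mem v
      · exact zero_mem _
  | src_mul_edge α i hi =>
    refine key _ ?_ (freeEdge_mem α i hi)
    simpa using mul_mem_freeComponent (freeVertex_mem (R := R) (E.src α)) (freeEdge_mem α i hi)
  | edge_mul_tgt α i hi =>
    refine key _ ?_ (freeEdge_mem α i hi)
    simpa using mul_mem_freeComponent (freeEdge_mem (R := R) α i hi) (freeVertex_mem (E.tgt α))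
  | tgt_mul_ghost α i hi =>
    refine key _ ?_ (freeGhost_mem α i hi)
    simpa using mul_mem_freeComponent (freeVertex_mem (R := R) (E.tgt α)) (freeGhost_mem α i hi)
  | ghost_mul_src α i hi =>
    refine key _ ?_ (freeGhost_mem α i hi)
    simpa using mul_mem_freeComponent (freeGhost_mem (R := R) α i hi) (freeVertex_mem (E.src α))
  | sum_edge_mul_ghost v i j hi hj =>
    have hex : ∀ k, k < E.maxWeight v → ∃ α, k < E.weight α := by
      intro k hk
      obtain ⟨α, -, hα⟩ := Finset.lt_sup_iff.mp hk
      exact ⟨α, hα⟩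
    refine key (Finsupp.single ⟨i, hex i hi⟩ 1 + -Finsupp.single ⟨j, hex j hj⟩ 1) ?_ ?_
    · refine AddSubgroup.sum_mem _ fun α _ => ?_
      by_cases h1 : i < E.weight α
      · by_cases h2 : j < E.weight α
        · exact mul_mem_freeComponent (freeEdge_mem α i h1) (freeGhost_mem α j h2)
        · simp [freeGhost, h2]
      · simp [freeEdge, h1]
    · split_ifs with h
      · subst h
        simpa using freeVertex_mem (R := R) v
      · exact zero_mem _
  | sum_ghost_mul_edge α β =>
    refine key 0 ?_ ?_
    · refine AddSubgroup.sum_mem _ fun i _ => ?_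
      by_cases h1 : i < E.weight α
      · by_cases h2 : i < E.weight β
        · simpa using mul_mem_freeComponent (freeGhost_mem (R := R) α i h1) (freeEdge_mem β i h2)
        · simp [freeEdge, h2]
      · simp [freeGhost, h1]
    · split_ifs
      · exact freeVertex_mem _
      · exact zero_mem _

theorem proj_mem_relIdeal {x : E.FreeRRing R} (hx : x ∈ E.relIdeal R) (g : E.GradingGroup) :
    proj g x ∈ E.relIdeal R := by
  classical
  let J : TwoSidedIdeal (E.FreeRRing R) := TwoSidedIdeal.mk'
    {x | ∀ g, proj g x ∈ E.relIdeal R}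
    (fun g => by rw [map_zero]; exact zero_mem _)
    (fun hx hy g => by rw [map_add]; exact add_mem (hx g) (hy g))
    (fun hx g => by rw [map_neg]; exact neg_mem (hx g))
    (by
      intro x y hy g
      induction x using MonoidAlgebra.induction_linear with
      | zero => rw [zero_mul, map_zero]; exact zero_mem _
      | add a b ha hb => rw [add_mul, map_add]; exact add_mem ha hb
      | single w r =>
        rw [proj_single_mul]
        exact TwoSidedIdeal.mul_mem_left _ _ _ (hy _))
    (by
      intro x y hx g
      induction y using MonoidAlgebra.induction_linear with
      | zero => rw [mul_zero, map_zero]; exact zero_mem _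
      | add a b ha hb => rw [mul_add, map_add]; exact add_mem ha hb
      | single w r =>
        rw [proj_mul_single]
        exact TwoSidedIdeal.mul_mem_right _ _ _ (hx _))
  have hJ : ∀ x, x ∈ J ↔ ∀ g, proj g x ∈ E.relIdeal R := fun x => TwoSidedIdeal.mem_mk' ..
  have hxJ : x ∈ J := by
    rw [relIdeal, TwoSidedIdeal.mem_sInf] at hx
    refine hx J ⟨fun a b hab => ?_, fun r y hy => ?_⟩
    · rw [hJ]
      intro g
      obtain ⟨k, hk⟩ := hab.homogeneous
      rw [proj_of_mem hk]
      split_ifs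
      · exact sub_mem_relIdeal hab
      · exact zero_mem _
    · rw [hJ] at hy
      refine ⟨(hJ _).2 fun g => ?_, (hJ _).2 fun g => ?_⟩
      · rw [proj_smul]
        exact (smul_mem_relIdeal (hy g) r).1
      · rw [proj_op_smul]
        exact (smul_mem_relIdeal (hy g) r).2
  exact (hJ x).1 hxJ g

theorem isInternal_component : DirectSum.IsInternal (E.component R) := by
  classical
  constructor
  · rw [injective_iff_map_eq_zero]
    intro d hd
    have hrep : ∀ i, ∃ f ∈ E.freeComponent R i,
        E.toLeavitt R f = (d i : E.LeavittPathAlgebra R) := fun i => (d i).2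
    choose f hf hfd using hrep
    rw [DirectSum.coeAddMonoidHom_eq_dfinsuppSum, DFinsupp.sum] at hd
    have h0 : (∑ i ∈ d.support, f i) ∈ E.relIdeal R := by
      rw [← toLeavitt_eq_zero_iff, map_sum]
      simpa only [hfd] using hd
    ext g
    by_cases hg : g ∈ d.support
    · have h1 := proj_mem_relIdeal h0 g
      rw [map_sum, Finset.sum_congr rfl (fun i _ => proj_of_mem (hf i)),
        Finset.sum_ite_eq' , if_pos hg, ← toLeavitt_eq_zero_iff, hfd] at h1
      simpa using h1
    · simpa using hg
  · intro a
    obtain ⟨x, rfl⟩ := toLeavitt_surjective a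
    induction x using MonoidAlgebra.induction_linear with
    | zero => exact ⟨0, by simp⟩
    | add x y hx hy =>
      obtain ⟨a, ha⟩ := hx
      obtain ⟨b, hb⟩ := hy
      exact ⟨a + b, by rw [map_add, map_add, ha, hb]⟩
    | single w r =>
      exact ⟨DirectSum.of (fun g => E.component R g) (E.degree w)
        ⟨E.toLeavitt R (MonoidAlgebra.single w r), _, single_mem_freeComponent w r, rfl⟩,
        by rw [DirectSum.coeAddMonoidHom_of]⟩

instance : SetLike.GradedMul (E.component R) where
  mul_mem _ _ _ _ hx hy := mul_mem_component hx hy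

noncomputable instance : DirectSum.Decomposition (E.component R) :=
  isInternal_component.chooseDecomposition

end Grading

end WeightedGraph

namespace WeightedGraph

variable {V S : Type*} {E : WeightedGraph V S}

open Polynomial

/-! The homogeneous element `α_0` fails to be regular whenever its source emits a second structured
edge and all weights are at least two. It suffices to represent the algebra so that the image `a` of
`α_0` satisfies no equation `a b a = a`.

Put `T = R[X]` and let right `T`-linear maps act on functions `V × ℕ → T`. Each vertex gets a copy
of `ℕ`. For fixed `u` and `i`, the domains of the edges `α_i` partition the copy at `u`. For fixed
`α`, the ranges of the `α_i` are the residue classes modulo `ω(α)` in the copy at the target. These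
partial bijections satisfy the relations (`bijectionFamily`).

The relations survive an invertible central change of the first two rows (`twist`), after which
`α_0` acts as `X · edge_0 - edge_1`. The enumerations are chosen so that row 0 starts with `α` and
row 1 with another edge (`exists_enumeration`). Then the matrix of `a` has an entry `X` that is
alone in its row and column, so `a b a = a` would give `X c X = X` in `R[X]`
(`twist_edge_zero_not_regular`). Comparing coefficients of `X` yields `0 = 1` in `R`. -/

theorem mem_out {v : V} {α : S} : α ∈ E.out v ↔ E.src α = v := by simp [out]

theorem weight_le_maxWeight (α : S) : E.weight α ≤ E.maxWeight (E.src α) :=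
  Finset.le_sup (f := E.weight) (mem_out.2 rfl)

/-! ### Families satisfying the defining relations -/

open Classical in
/-- A family of elements of a ring `B` indexed by the letters that satisfies the defining relations
of the weighted Leavitt path algebra. -/
structure LeavittFamily (E : WeightedGraph V S) (B : Type*) [Ring B] where
  vertex : V → B
  edge : S → ℕ → B
  ghost : S → ℕ → B
  edge_eq_zero : ∀ α i, E.weight α ≤ i → edge α i = 0
  ghost_eq_zero : ∀ α i, E.weight α ≤ i → ghost α i = 0
  vertex_mul : ∀ v w, vertex v * vertex w = if v = w then vertex v else 0
  src_mul_edge : ∀ α i, vertex (E.src α) * edge α i = edge α i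
  edge_mul_tgt : ∀ α i, edge α i * vertex (E.tgt α) = edge α i
  tgt_mul_ghost : ∀ α i, vertex (E.tgt α) * ghost α i = ghost α i
  ghost_mul_src : ∀ α i, ghost α i * vertex (E.src α) = ghost α i
  sum_edge_mul_ghost : ∀ v i j, i < E.maxWeight v → j < E.maxWeight v →
    ∑ α ∈ E.out v, edge α i * ghost α j = if i = j then vertex v else 0
  sum_ghost_mul_edge : ∀ α β,
    ∑ i ∈ Finset.range (max (E.weight α) (E.weight β)), ghost α i * edge β i =
      if α = β then vertex (E.tgt α) else 0

namespace LeavittFamily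

variable {B : Type*} [Ring B] (F : LeavittFamily E B)

/-- The element of the family that belongs to a letter. -/
def letter : E.Letter → B
  | .vertex v => F.vertex v
  | .edge α i => F.edge α i
  | .ghost α i => F.ghost α i

/-! ### The map out of the free `R`-ring and its kernel. -/

section Lift

variable {R : Type*} [Ring R] (f : R →+* B)

/-- The map from the free `R`-ring induced by a family and a ring homomorphism on scalars. -/
noncomputable def lift : E.FreeRRing R →+ B :=
  MonoidAlgebra.liftNC (f : R →+ B) (FreeSemigroup.lift F.letter)

theorem lift_single (w : FreeSemigroup E.Letter) (r : R) :
    F.lift f (MonoidAlgebra.single w r) = f r * FreeSemigroup.lift F.letter w :=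
  MonoidAlgebra.liftNC_single _ _ _ _

@[simp]
theorem lift_freeVertex (v : V) : F.lift f (E.freeVertex R v) = F.vertex v := by
  simp [freeVertex, lift_single, letter]

@[simp]
theorem lift_freeEdge (α : S) (i : ℕ) : F.lift f (E.freeEdge R α i) = F.edge α i := by
  unfold freeEdge
  split_ifs with h
  · simp [lift_single, letter]
  · rw [map_zero, F.edge_eq_zero α i (not_lt.1 h)]

@[simp]
theorem lift_freeGhost (α : S) (i : ℕ) : F.lift f (E.freeGhost R α i) = F.ghost α i := by
  unfold freeGhost
  split_ifs with h
  · simp [lift_single, letter]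
  · rw [map_zero, F.ghost_eq_zero α i (not_lt.1 h)]

variable {f}

theorem commute_word (hf : ∀ r x, Commute (f r) (F.letter x))
    (r : R) (w : FreeSemigroup E.Letter) :
    Commute (f r) (FreeSemigroup.lift F.letter w) := by
  induction w using FreeSemigroup.recOnMul with
  | ih1 x => simpa using hf r x
  | ih2 x y hx hy => rw [map_mul]; exact hx.mul_right hy

theorem lift_mul (hf : ∀ r x, Commute (f r) (F.letter x))
    (x y : E.FreeRRing R) : F.lift f (x * y) = F.lift f x * F.lift f y :=
  MonoidAlgebra.liftNC_mul f _ x y fun _ => F.commute_word hf _ _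

theorem lift_smul (r : R) (x : E.FreeRRing R) : F.lift f (r • x) = f r * F.lift f x := by
  induction x using MonoidAlgebra.induction_linear with
  | zero => simp
  | add x y hx hy => rw [smul_add, map_add, map_add, hx, hy, mul_add]
  | single w s =>
    rw [MonoidAlgebra.smul_single, lift_single, lift_single, smul_eq_mul, map_mul, mul_assoc]

theorem lift_op_smul (hf : ∀ r x, Commute (f r) (F.letter x))
    (r : R) (x : E.FreeRRing R) :
    F.lift f (MulOpposite.op r • x) = F.lift f x * f r := by
  induction x using MonoidAlgebra.induction_linear with
  | zero => simp
  | add x y hx hy => rw [smul_add, map_add, map_add, hx, hy, add_mul]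
  | single w s =>
    rw [MonoidAlgebra.smul_single, lift_single, lift_single, op_smul_eq_mul, map_mul, mul_assoc,
      mul_assoc, (F.commute_word hf r w).eq]

theorem lift_eq_of_rel (hf : ∀ r x, Commute (f r) (F.letter x))
    {x y : E.FreeRRing R} (h : E.Rel R x y) : F.lift f x = F.lift f y := by
  cases h with
  | vertex_mul v w =>
    rw [F.lift_mul hf, lift_freeVertex, lift_freeVertex, F.vertex_mul]; split_ifs <;> simp
  | src_mul_edge α i => simp [F.lift_mul hf, F.src_mul_edge]
  | edge_mul_tgt α i => simp [F.lift_mul hf, F.edge_mul_tgt]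
  | tgt_mul_ghost α i => simp [F.lift_mul hf, F.tgt_mul_ghost]
  | ghost_mul_src α i => simp [F.lift_mul hf, F.ghost_mul_src]
  | sum_edge_mul_ghost v i j hi hj =>
    simp only [map_sum, F.lift_mul hf, lift_freeEdge, lift_freeGhost,
      F.sum_edge_mul_ghost v i j hi hj]
    split_ifs <;> simp
  | sum_ghost_mul_edge α β =>
    simp only [map_sum, F.lift_mul hf, lift_freeEdge, lift_freeGhost, F.sum_ghost_mul_edge]
    split_ifs <;> simp

/-- The kernel of the lift is itself a two-sided ideal and `R`-subbimodule containing the relations,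
so it occurs in the infimum defining `relIdeal`. -/
theorem lift_eq_zero (hf : ∀ r x, Commute (f r) (F.letter x))
    {x : E.FreeRRing R} (hx : x ∈ E.relIdeal R) : F.lift f x = 0 := by
  let Φ : E.FreeRRing R →ₙ+* B := { F.lift f with map_mul' := F.lift_mul hf }
  have hΦ : ∀ x, x ∈ TwoSidedIdeal.ker Φ ↔ F.lift f x = 0 := fun x => TwoSidedIdeal.mem_ker Φ
  rw [relIdeal, TwoSidedIdeal.mem_sInf] at hx
  refine (hΦ x).1 (hx _ ⟨fun a b hab => ?_, fun r a ha => ?_⟩)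
  · rw [hΦ, map_sub, F.lift_eq_of_rel hf hab, sub_self]
  · rw [hΦ] at ha
    rw [hΦ, hΦ, F.lift_smul, F.lift_op_smul hf, ha, mul_zero, zero_mul]
    exact ⟨rfl, rfl⟩

/-- Regularity passes to images: the equation holds modulo `relIdeal`, which the lift kills. To
refute regularity it is enough to do so in one ring `B`. -/
theorem exists_edge_mul_mul_edge (hf : ∀ r x, Commute (f r) (F.letter x))
    {α : S} {i : ℕ}
    (h : ∃ b, E.toLeavitt R (E.freeEdge R α i) * b * E.toLeavitt R (E.freeEdge R α i) =
      E.toLeavitt R (E.freeEdge R α i)) :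
    ∃ b : B, F.edge α i * b * F.edge α i = F.edge α i := by
  obtain ⟨b, hb⟩ := h
  obtain ⟨y, rfl⟩ := toLeavitt_surjective b
  rw [← map_mul, ← map_mul, ← sub_eq_zero, ← map_sub, toLeavitt_eq_zero_iff] at hb
  have := F.lift_eq_zero hf hb
  rw [map_sub, F.lift_mul hf, F.lift_mul hf, lift_freeEdge, sub_eq_zero] at this
  exact ⟨_, this⟩

end Lift

/-- If all weights are at least two, multiplying the first two rows of all edge matrices by
the invertible matrix `!![t, -1; 1, 0]` with `t` central gives another family. -/
def twist (h2 : ∀ α, 2 ≤ E.weight α) (t : B) (ht : ∀ b, Commute t b) : LeavittFamily E B where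
  vertex := F.vertex
  edge α
    | 0 => t * F.edge α 0 - F.edge α 1
    | 1 => F.edge α 0
    | i + 2 => F.edge α (i + 2)
  ghost α
    | 0 => -F.ghost α 1
    | 1 => F.ghost α 0 + t * F.ghost α 1
    | i + 2 => F.ghost α (i + 2)
  -- Weights are at least two, so an index beyond the weight is at least two and lies in an
  -- untouched row.
  edge_eq_zero α i hi := by
    obtain ⟨i, rfl⟩ := Nat.exists_eq_add_of_le' ((h2 α).trans hi)
    exact F.edge_eq_zero _ _ hi
  ghost_eq_zero α i hi := by
    obtain ⟨i, rfl⟩ := Nat.exists_eq_add_of_le' ((h2 α).trans hi)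
    exact F.ghost_eq_zero _ _ hi
  vertex_mul := F.vertex_mul
  src_mul_edge α i := by
    rcases i with _ | _ | i
    · simp only [mul_sub, ← mul_assoc, ← (ht (F.vertex (E.src α))).eq]
      simp only [mul_assoc, F.src_mul_edge]
    · exact F.src_mul_edge _ _
    · exact F.src_mul_edge _ _
  edge_mul_tgt α i := by
    rcases i with _ | _ | i
    · simp only [sub_mul, mul_assoc, F.edge_mul_tgt]
    · exact F.edge_mul_tgt _ _
    · exact F.edge_mul_tgt _ _
  tgt_mul_ghost α i := by
    rcases i with _ | _ | i
    · simp only [mul_neg, F.tgt_mul_ghost]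
    · simp only [mul_add, ← mul_assoc, ← (ht (F.vertex (E.tgt α))).eq]
      simp only [mul_assoc, F.tgt_mul_ghost]
    · exact F.tgt_mul_ghost _ _
  ghost_mul_src α i := by
    rcases i with _ | _ | i
    · simp only [neg_mul, F.ghost_mul_src]
    · simp only [add_mul, mul_assoc, F.ghost_mul_src]
    · exact F.ghost_mul_src _ _
  sum_edge_mul_ghost v i j hi hj := by
    -- Mixing rows 0 and 1 needs the original relations for both of them, even if only one occurs in
    -- the goal.
    have h2v : 2 ≤ E.maxWeight v := by
      obtain ⟨α, hα, -⟩ := Finset.lt_sup_iff.mp hi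
      exact (h2 α).trans (Finset.le_sup hα)
    have key := F.sum_edge_mul_ghost v
    have ht' : ∀ a b : B, a * (t * b) = t * (a * b) := fun a b => by
      rw [← mul_assoc, ← (ht a).eq, mul_assoc]
    rcases i with _ | _ | i <;> rcases j with _ | _ | j <;>
      simp only [sub_mul, mul_add, mul_neg, mul_assoc, ht', Finset.sum_add_distrib,
        Finset.sum_sub_distrib, Finset.sum_neg_distrib, ← Finset.mul_sum] <;>
      repeat rw [key _ _ (by omega) (by omega)] <;>
      simp
  sum_ghost_mul_edge α β := by
    obtain ⟨n, hn⟩ := Nat.exists_eq_add_of_le' ((h2 α).trans (le_max_left _ (E.weight β)))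
    rw [← F.sum_ghost_mul_edge α β, hn]
    -- Only the terms of index 0 and 1 change; in their sum the two contributions `t · ghost_1 ·
    -- edge_0` cancel.
    simp only [Finset.sum_range_succ', add_assoc]
    congr 1
    have ht' : ∀ a b : B, a * (t * b) = t * (a * b) := fun a b => by
      rw [← mul_assoc, ← (ht a).eq, mul_assoc]
    simp only [zero_add, mul_sub, add_mul, neg_mul, mul_neg, mul_assoc, ht']
    abel

end LeavittFamily

/-! ### A family of partial bijections -/

/-- The edges of index `i` leaving `v` form a countable nonempty set, so its product with `ℕ` is in
bijection with `ℕ`: each edge receives infinitely many positions. -/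
theorem exists_row_enumeration [Countable S] (v : V) (i : ℕ) (α : S) (hv : E.src α = v)
    (hα : i < E.weight α) :
    ∃ (e : ℕ → S × ℕ) (e' : S → ℕ → ℕ),
      (∀ n, E.src (e n).1 = v ∧ i < E.weight (e n).1 ∧ e' (e n).1 (e n).2 = n) ∧
      (∀ β k, E.src β = v → i < E.weight β → e (e' β k) = (β, k)) ∧ (e 0).1 = α := by
  classical
  let K := {β : S // E.src β = v ∧ i < E.weight β}
  let a : K := ⟨α, hv, hα⟩
  have : Nonempty K := ⟨a⟩
  obtain ⟨σ⟩ := nonempty_equiv_of_countable (α := ℕ) (β := K × ℕ)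
  -- The transposition moves `α` to position 0.
  let τ : ℕ ≃ K × ℕ := (Equiv.swap 0 (σ.symm (a, 0))).trans σ
  have hτ : τ 0 = (a, 0) := by simp [τ]
  refine ⟨fun n => ((τ n).1, (τ n).2),
    fun β k => if h : E.src β = v ∧ i < E.weight β then τ.symm (⟨β, h⟩, k) else 0, ?_, ?_, ?_⟩
  · intro n
    refine ⟨(τ n).1.2.1, (τ n).1.2.2, ?_⟩
    simp [(τ n).1.2.1, (τ n).1.2.2]
  · intro β k h1 h2
    simp [h1, h2]
  · simp [hτ, a]

theorem exists_enumeration [Countable S] {v : V} {α β : S} (hα : E.src α = v) (hβ : E.src β = v)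
    (hα0 : 0 < E.weight α) (hβ1 : 1 < E.weight β) :
    ∃ (e : V → ℕ → ℕ → S × ℕ) (e' : S → ℕ → ℕ → ℕ),
      (∀ u i n, i < E.maxWeight u → E.src (e u i n).1 = u ∧ i < E.weight (e u i n).1 ∧
        e' (e u i n).1 i (e u i n).2 = n) ∧
      (∀ γ i k, i < E.weight γ → e (E.src γ) i (e' γ i k) = (γ, k)) ∧
      (e v 0 0).1 = α ∧ (e v 1 0).1 = β := by
  have h : ∀ u i, ∃ (e : ℕ → S × ℕ) (e' : S → ℕ → ℕ), i < E.maxWeight u →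
      (∀ n, E.src (e n).1 = u ∧ i < E.weight (e n).1 ∧ e' (e n).1 (e n).2 = n) ∧
      (∀ γ k, E.src γ = u → i < E.weight γ → e (e' γ k) = (γ, k)) ∧
      (u = v → i = 0 → (e 0).1 = α) ∧ (u = v → i = 1 → (e 0).1 = β) := by
    intro u i
    by_cases hi : i < E.maxWeight u
    · have : ∃ γ, E.src γ = u ∧ i < E.weight γ ∧ (u = v → i = 0 → γ = α) ∧
          (u = v → i = 1 → γ = β) := by
        by_cases h0 : u = v ∧ i = 0
        · exact ⟨α, by rw [hα, h0.1], by rw [h0.2]; exact hα0, fun _ _ => rfl, by omega⟩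
        by_cases h1 : u = v ∧ i = 1
        · exact ⟨β, by rw [hβ, h1.1], by rw [h1.2]; exact hβ1, by omega, fun _ _ => rfl⟩
        obtain ⟨γ, hγ, hγi⟩ := Finset.lt_sup_iff.mp hi
        exact ⟨γ, mem_out.1 hγ, hγi, fun a b => absurd ⟨a, b⟩ h0, fun a b => absurd ⟨a, b⟩ h1⟩
      obtain ⟨γ, h1, h2, h3, h4⟩ := this
      obtain ⟨e, e', he, he', h⟩ := exists_row_enumeration u i γ h1 h2
      exact ⟨e, e', fun _ => ⟨he, he', by rwa [h], by rwa [h]⟩⟩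
    -- Nonexistent rows get a junk value.
    · exact ⟨fun _ => (α, 0), fun _ _ => 0, fun h => absurd h hi⟩
  choose e e' h using h
  refine ⟨e, fun γ i k => e' (E.src γ) i γ k, fun u i n hi => ?_, fun γ i k hi => ?_, ?_, ?_⟩
  · obtain ⟨h1, h2, h3⟩ := (h u i hi).1 n
    exact ⟨h1, h2, by simp only [h1, h3]⟩
  · exact (h _ i (hi.trans_le (weight_le_maxWeight γ))).2.1 γ k rfl hi
  · exact (h v 0 (hα ▸ hα0.trans_le (weight_le_maxWeight α))).2.2.1 rfl rfl
  · exact (h v 1 (hβ ▸ hβ1.trans_le (weight_le_maxWeight β))).2.2.2 rfl rfl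

/-! ### Operators given by partial maps of the index set. -/

section Pullback

variable {I : Type*} (T : Type*) [Ring T]

open Classical in
/-- Composition with a partial map of the index set, extended by zero. -/
noncomputable def pullback (c : I → Prop) (φ : I → I) : Module.End Tᵐᵒᵖ (I → T) where
  toFun h x := if c x then h (φ x) else 0
  map_add' h k := by ext x; by_cases hx : c x <;> simp [hx]
  map_smul' r h := by ext x; by_cases hx : c x <;> simp [hx]

open Classical in
theorem pullback_apply (c : I → Prop) (φ : I → I) (h : I → T) (x : I) :
    pullback T c φ h x = if c x then h (φ x) else 0 := rfl

/-- Functions form a right `T`-module so that left multiplication by a scalar is linear for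
noncommutative `T`; it acts in each coordinate, hence commutes with moving coordinates. -/
theorem commute_toModuleEnd_pullback (r : T) (c : I → Prop) (φ : I → I) :
    Commute (Module.toModuleEnd Tᵐᵒᵖ (I → T) r) (pullback T c φ) := by
  ext1 h
  ext x
  by_cases hx : c x <;> simp [pullback_apply, hx]

end Pullback

section PartialBijections

variable (T : Type*) [Ring T] (e : V → ℕ → ℕ → S × ℕ) (e' : S → ℕ → ℕ → ℕ)
  (he : ∀ u i n, i < E.maxWeight u → E.src (e u i n).1 = u ∧ i < E.weight (e u i n).1 ∧
    e' (e u i n).1 i (e u i n).2 = n)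
  (he' : ∀ γ i k, i < E.weight γ → e (E.src γ) i (e' γ i k) = (γ, k))

open Classical in
/-- The family of partial bijections of `V × ℕ` given by an enumeration of the rows of
the edge matrices. -/
noncomputable def bijectionFamily : LeavittFamily E (Module.End Tᵐᵒᵖ (V × ℕ → T)) where
  vertex v := pullback T (fun x => x.1 = v) id
  edge α i := pullback T (fun x => x.1 = E.src α ∧ i < E.weight α ∧ (e (E.src α) i x.2).1 = α)
    (fun x => (E.tgt α, E.weight α * (e (E.src α) i x.2).2 + i))
  ghost α i := pullback T (fun x => x.1 = E.tgt α ∧ x.2 % E.weight α = i)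
    (fun x => (E.src α, e' α i (x.2 / E.weight α)))
  edge_eq_zero α i hi := by
    ext h x
    simp [pullback_apply, not_lt.2 hi]
  ghost_eq_zero α i hi := by
    ext h x
    have := Nat.mod_lt x.2 (E.weight_pos α)
    rw [pullback_apply, if_neg (by omega)]
    rfl
  vertex_mul v w := by
    ext h x
    by_cases hv : x.1 = v <;> by_cases hw : v = w <;> simp_all [pullback_apply]
  src_mul_edge α i := by
    ext h x
    by_cases hv : x.1 = E.src α <;> simp [pullback_apply, hv]
  edge_mul_tgt α i := by
    ext h x
    simp [pullback_apply]
  tgt_mul_ghost α i := by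
    ext h x
    by_cases hv : x.1 = E.tgt α <;> simp [pullback_apply, hv]
  ghost_mul_src α i := by
    ext h x
    simp [pullback_apply]
  sum_edge_mul_ghost v i j hi hj := by
    ext h ⟨u, n⟩
    rw [LinearMap.sum_apply, Finset.sum_apply]
    by_cases hu : u = v
    · subst hu
      obtain ⟨h1, h2, h3⟩ := he u i n hi
      set γ := (e u i n).1 with hγ
      -- Position `n` of row `i` belongs to `γ` alone.
      rw [Finset.sum_eq_single γ]
      · have hm : (E.weight γ * (e u i n).2 + i) % E.weight γ = i := by
          rw [Nat.mul_add_mod, Nat.mod_eq_of_lt h2]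
        have hd : (E.weight γ * (e u i n).2 + i) / E.weight γ = (e u i n).2 := by
          rw [Nat.mul_add_div (E.weight_pos γ), Nat.div_eq_of_lt h2, add_zero]
        by_cases hij : i = j
        · subst hij
          simp [pullback_apply, h1, h2, hm, hd, h3, ← hγ]
        · simp [pullback_apply, h1, hm, hij]
      · intro α hα hne
        rw [mem_out] at hα
        have : ¬ (e (E.src α) i n).1 = α := by rw [hα]; exact fun h => hne h.symm
        simp [pullback_apply, this]
      · intro h
        exact absurd (mem_out.2 h1) h
    · rw [Finset.sum_eq_zero]
      · split_ifs <;> simp [pullback_apply, hu]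
      · intro α hα
        rw [mem_out] at hα
        simp [pullback_apply, hα, hu]
  sum_ghost_mul_edge α β := by
    ext h ⟨u, n⟩
    rw [LinearMap.sum_apply, Finset.sum_apply]
    have hlt := Nat.mod_lt n (E.weight_pos α)
    -- Position `n` lies in exactly one residue class modulo the weight of `α`.
    rw [Finset.sum_eq_single (n % E.weight α)]
    · by_cases hu : u = E.tgt α
      · subst hu
        have h1 := he' α _ (n / E.weight α) hlt
        by_cases hs : E.src α = E.src β
        · rw [hs] at h1
          by_cases hαβ : α = β
          · subst hαβ
            simp [pullback_apply, h1, hlt, Nat.div_add_mod]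
          · simp [pullback_apply, h1, hs, hαβ]
        · have : α ≠ β := by rintro rfl; exact hs rfl
          simp [pullback_apply, hs, this]
      · split_ifs <;> simp [pullback_apply, hu]
    · intro i _ hi
      simp [pullback_apply, hi.symm]
    · intro h
      exact absurd (Finset.mem_range.2 (hlt.trans_le (le_max_left _ _))) h

end PartialBijections

/-! ### An isolated matrix entry that obstructs regularity. -/

open Classical in
-- Row `y` and column `z` of `a` contain only the entry `t`, at their intersection. Hence the `(y,
-- z)` entry of `a b a` is `t c t`, where `c` is the `(z, y)` entry of `b`.
theorem twist_edge_zero_not_regular {T : Type*} [Ring T] {h2 : ∀ α, 2 ≤ E.weight α}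
    {e : V → ℕ → ℕ → S × ℕ} {e' : S → ℕ → ℕ → ℕ} {he he'} {α : S}
    (h0 : (e (E.src α) 0 0).1 = α) (h1 : (e (E.src α) 1 0).1 ≠ α) {t : T} {ht}
    {a b : Module.End Tᵐᵒᵖ (V × ℕ → T)}
    (ha : a = ((bijectionFamily (E := E) T e e' he he').twist h2
      (Module.toModuleEnd Tᵐᵒᵖ (V × ℕ → T) t) ht).edge α 0)
    (hb : a * b * a = a) : ∃ c, t * c * t = t := by
  let k := (e (E.src α) 0 0).2
  let y : V × ℕ := (E.src α, 0)
  let z : V × ℕ := (E.tgt α, E.weight α * k)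
  -- Position 0 of row 1 belongs to another edge, so the `edge_1` term vanishes at `y`.
  have hval : ∀ f, a f y = t * f z := by
    intro f
    simp [ha, LeavittFamily.twist, bijectionFamily, pullback_apply, y, z, k, h0, h1,
      E.weight_pos α]
  have hpos := E.weight_pos α
  -- The scalar stands on the right, so that it can be pulled through the right linear map `b`.
  have hdelta : a (Pi.single z 1) = MulOpposite.op t • Pi.single y 1 := by
    ext x
    -- The `edge_1` term only reaches positions congruent to 1 modulo the weight, which is at least
    -- two; `z` is congruent to 0.
    have h1' : ∀ m, E.weight α * m + 1 ≠ E.weight α * k := fun m hm => by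
      have := congrArg (· % E.weight α) hm
      simp [Nat.mod_eq_of_lt (h2 α)] at this
    by_cases hx : x = y
    · subst hx
      rw [hval]
      simp
    · obtain ⟨u, m⟩ := x
      -- By injectivity of the enumeration, `edge_0` reaches `z` only from `y`.
      have hne : u = E.src α → (e (E.src α) 0 m).1 = α → (e (E.src α) 0 m).2 ≠ k := by
        rintro rfl hm hk
        have hw : 0 < E.maxWeight (E.src α) := hpos.trans_le (weight_le_maxWeight α)
        refine hx (Prod.ext rfl ?_)
        have hmn := (he (E.src α) 0 m hw).2.2
        rw [hm, hk] at hmn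
        have h0n := (he (E.src α) 0 0 hw).2.2
        rw [h0] at h0n
        exact hmn.symm.trans h0n
      simp only [ha, LeavittFamily.twist, bijectionFamily, LinearMap.sub_apply,
        Module.End.mul_apply, Module.toModuleEnd_apply, Pi.sub_apply, pullback_apply,
        Pi.smul_apply, Pi.single_apply, z, hx, DistribSMul.toLinearMap_apply]
      split_ifs <;> simp_all
  have := congrFun (LinearMap.congr_fun hb (Pi.single z 1)) y
  rw [Module.End.mul_apply, Module.End.mul_apply, hval, hdelta, map_smul] at this
  refine ⟨b (Pi.single y 1) z, ?_⟩
  simpa [mul_assoc] using this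

theorem commute_letter_twist_bijectionFamily {T : Type*} [Ring T] {h2 : ∀ α, 2 ≤ E.weight α}
    {e : V → ℕ → ℕ → S × ℕ} {e' : S → ℕ → ℕ → ℕ} {he he'}
    {t : Module.End Tᵐᵒᵖ (V × ℕ → T)} {ht} (r : T) (x : E.Letter) :
    Commute (Module.toModuleEnd Tᵐᵒᵖ (V × ℕ → T) r)
      (((bijectionFamily (E := E) T e e' he he').twist h2 t ht).letter x) := by
  have h := commute_toModuleEnd_pullback (I := V × ℕ) T r
  have htr := (ht (Module.toModuleEnd Tᵐᵒᵖ (V × ℕ → T) r)).symm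
  rcases x with v | ⟨α, _ | _ | i, _⟩ | ⟨α, _ | _ | i, _⟩
  · exact h _ _
  · exact (htr.mul_right (h _ _)).sub_right (h _ _)
  · exact h _ _
  · exact h _ _
  · exact (h _ _).neg_right
  · exact (h _ _).add_right (htr.mul_right (h _ _))
  · exact h _ _

/-- As `X` is central in `R[X]`, multiplying by it on the left is the same as on the right, and `b`
is right linear. This makes `X` admissible as the twisting parameter. -/
theorem commute_toModuleEnd_X {R I : Type*} [Ring R] (b : Module.End R[X]ᵐᵒᵖ (I → R[X])) :
    Commute (Module.toModuleEnd R[X]ᵐᵒᵖ (I → R[X]) (X : R[X])) b := by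
  have h : ∀ f : I → R[X], (X : R[X]) • f = MulOpposite.op (X : R[X]) • f := fun f => by
    ext1 x
    simp [X_mul]
  ext1 f
  simp [h]

/-- An edge with index zero whose source emits another structured edge is not von Neumann regular
if all weights are at least two. -/
theorem not_regular_edge_zero [Countable S] (h2 : ∀ α, 2 ≤ E.weight α) {α β : S} (hαβ : α ≠ β)
    (hs : E.src β = E.src α) (R : Type*) [Ring R] [Nontrivial R] :
    ¬ ∃ b, E.toLeavitt R (E.freeEdge R α 0) * b * E.toLeavitt R (E.freeEdge R α 0) =
      E.toLeavitt R (E.freeEdge R α 0) := by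
  intro h
  obtain ⟨e, e', he, he', h0, h1⟩ := exists_enumeration (E := E) rfl hs (E.weight_pos α) (h2 β)
  let F := (bijectionFamily R[X] e e' he he').twist h2 _ commute_toModuleEnd_X
  obtain ⟨b, hb⟩ := F.exists_edge_mul_mul_edge
    (f := (Module.toModuleEnd R[X]ᵐᵒᵖ (V × ℕ → R[X])).comp C)
    (fun r x => commute_letter_twist_bijectionFamily (C r) x) h
  obtain ⟨c, hc⟩ := twist_edge_zero_not_regular h0 (by rw [h1]; exact hαβ.symm) rfl hb
  -- The coefficient of `X` is 0 in `X c X` and 1 in `X`; `0 + 1` is the form that `coeff_mul_X`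
  -- expects.
  have hcoeff := congrArg (coeff · (0 + 1)) hc
  rw [X_mul, coeff_mul_X, mul_coeff_zero, coeff_X_zero, mul_zero, zero_add, coeff_X_one] at hcoeff
  exact zero_ne_one hcoeff

end WeightedGraph

theorem mainTheorem12 {V S : Type*} [Countable V] [Countable S] (E : WeightedGraph V S)
    (hE : E.IsLV) (R : Type*) [Ring R] [IsDomain R] :
    ¬ IsGradedVonNeumannRegular (E.component R) ∧
      ¬ IsVonNeumannRegular (E.LeavittPathAlgebra R) := by
  have key : ¬ IsGradedVonNeumannRegular (E.component R) := by
    intro hreg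
    obtain ⟨α₀⟩ := hE.nonempty
    -- The LV condition at a vertex that is not a sink supplies two different structured edges with
    -- the same source.
    obtain ⟨α, hα, β, hβ, hαβ⟩ := Finset.one_lt_card.1
      (hE.two_le_card (E.src α₀) ⟨α₀, WeightedGraph.mem_out.2 rfl⟩)
    have hα := WeightedGraph.mem_out.1 (Finset.mem_filter.1 hα).1
    have hβ := WeightedGraph.mem_out.1 (Finset.mem_filter.1 hβ).1
    exact WeightedGraph.not_regular_edge_zero hE.two_le_weight hαβ (hβ.trans hα.symm) R
      (hreg _ ⟨_, _, WeightedGraph.freeEdge_mem α 0 (E.weight_pos α), rfl⟩)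
  exact ⟨key, fun h => key fun a _ => h a⟩
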